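/- Let $(\mathcal V^+,g^+)$ be a $G_4$-on-$S_3$ locally rotationally symmetric (LRS) spacetime, i.e. in coordinates $(t,r,\varphi,z)$, with $t$ in an open interval, $$ds^{2+}=-dt^2+a(t)^2\bigl(dz+n(F(r,k)+k)\,d\varphi\bigr)^2+b(t)^2\bigl[(dr-\epsilon r\,dz)^2+\Sigma(r,k)^2d\varphi^2\bigr],$$ where $a,b>0$ are $C^2$, $\epsilon,n\in\{0,1\}$, $k\in\{-1,0,1\}$, $\epsilon n=\epsilon k=0$; $\Sigma(r,k)=\sin r,\ r,\ \sinh r$ and $F(r,k)=-\cos r,\ r^2/2,\ \cosh r$ for $k=1,0,-1$ respectively; $r>0$, and $r<\pi$ if $k=1$. Let $(\mathcal V^-,g^-)$ be a static, orthogonally transitive (OT), cylindrically symmetric spacetime, i.e. in coordinates $(T,\rho,\tilde\varphi,\tilde z)$, with $\rho$ in an open interval, $$ds^{2-}=-A^2dT^2+B^2d\rho^2+C^2d\tilde\varphi^2+D^2d\tilde z^2+2E\,d\tilde\varphi\,d\tilde z,$$ where $A,B,C,D>0$ and $E$ are $C^2$ functions of $\rho$ with $C^2D^2-E^2>0$.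 Let $\sigma$ be a connected 3-dimensional hypersurface, given by a connected open coordinate domain in $\mathbb R^3$, and let $\Phi^\pm:\sigma\to\mathcal V^\pm$ be $C^3$ maps of rank 3 across which the two spacetimes are matched: the first fundamental forms induced on $\sigma$ by $g^+$ and $g^-$ coincide, and there are transversal vector fields (riggings) $\vec\ell^{\,\pm}$ along $\Phi^\pm$ with $\vec\ell^{\,+}\cdot\vec\ell^{\,+}=\vec\ell^{\,-}\cdot\vec\ell^{\,-}$ and $\vec\ell^{\,+}\cdot\vec e^{\,+}_a=\vec\ell^{\,-}\cdot\vec e^{\,-}_a$, where $\vec e^{\,\pm}_a=d\Phi^\pm(\partial/\partial\xi^a)$, such that the generalised second fundamental forms $H^\pm_{ab}=-\ell^\pm_\nu e_a^{\pm\mu}\nabla^\pm_\mu e_b^{\pm\nu}$ coincide. Suppose that the image of $\sigma$ is nowhere spacelike, and that the matching preserves the cylindrical symmetry: two vector fields on $\sigma$ are mapped by both $d\Phi^+$ and $d\Phi^-$ to the restrictions of generators of Abelian isometry groups $G_2$ with spacelike two-dimensional orbits at the hypersurface, the first being mapped to the axial Killing vectors $\partial_\varphi$ and $\partial_{\tilde\varphi}$,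 and the second to a Killing vector of $g^+$ which is tangent to the hypersurfaces $t=\text{const}$ and commutes with $\partial_\varphi$, and to a constant-coefficient linear combination of the generators $\partial_T,\partial_{\tilde\varphi},\partial_{\tilde z}$ of the Abelian group $G_3$ of isometries of $g^-$. Let $\mathcal I$ be the set of the values of $t$ which occur on $\Phi^+(\sigma)$, and suppose that the LRS spacetime is non-static there, i.e. that $a$ and $b$ are not both constant on $\mathcal I$. Then $n=0$ and there is a constant $\beta>0$ with $a(t)=\beta$ for all $t\in\mathcal I$. Hence, for $t\in\mathcal I$, the LRS metric is $$ds^2=-dt^2+\beta^2dz^2+b(t)^2\bigl[(dr-\epsilon r\,dz)^2+\Sigma(r,k)^2d\varphi^2\bigr],\qquad \epsilon\in\{0,1\},\quad \epsilon k=0,$$ and there is no expansion along one spacelike direction: the expansion tensor $\theta_{\alpha\beta}=\nabla_{(\alpha}u_{\beta)}$ of $\vec u=\partial_t$ satisfies $\theta_{\alpha\beta}s^\alpha s^\beta=0$ for $\vec s=\partial_z+\epsilon r\,\partial_r$. -/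

import Mathlib

open scoped Matrix

namespace CylMatching

noncomputable section

/-! ## Metrics on coordinate domains -/

/-- Points of a `d`-dimensional coordinate domain, and also coordinate components of vectors. -/
abbrev Coords (d : ℕ) : Type := Fin d → ℝ

/-- The components `g_{μν}` of a metric tensor in four coordinates. -/
abbrev MetricField : Type := Coords 4 → Matrix (Fin 4) (Fin 4) ℝ

/-- The partial derivative `∂f/∂xⁱ`. -/
def pderiv {d : ℕ} (i : Fin d) (f : Coords d → ℝ) (x : Coords d) : ℝ :=
  fderiv ℝ f x (Pi.single i 1)

/-- The scalar product `g_{μν} u^μ v^ν`. -/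
def gdot (g : Matrix (Fin 4) (Fin 4) ℝ) (u v : Coords 4) : ℝ := u ⬝ᵥ (g *ᵥ v)

/-- The Christoffel symbols `Γ^μ_{αβ}` of the Levi-Civita connection of `g`. -/
def christoffel (g : MetricField) (x : Coords 4) (μ α β : Fin 4) : ℝ :=
  (1 / 2) * ∑ ν, (g x)⁻¹ μ ν *
    (pderiv α (fun y => g y ν β) x + pderiv β (fun y => g y ν α) x
      - pderiv ν (fun y => g y α β) x)

/-- The components `(𝓛_ξ g)_{μν}` of the Lie derivative of the metric along `ξ`. -/
def lieMetric (g : MetricField) (ξ : Coords 4 → Coords 4) (x : Coords 4) (μ ν : Fin 4) : ℝ :=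
  ∑ α, (ξ x α * pderiv α (fun y => g y μ ν) x
    + g x α ν * pderiv μ (fun y => ξ y α) x
    + g x μ α * pderiv ν (fun y => ξ y α) x)

/-- `ξ` is a Killing vector field of `g` on the (open) domain `M`. -/
def IsKilling (g : MetricField) (M : Set (Coords 4)) (ξ : Coords 4 → Coords 4) : Prop :=
  ContDiffOn ℝ 1 ξ M ∧ ∀ x ∈ M, ∀ μ ν, lieMetric g ξ x μ ν = 0

/-- The expansion tensor `θ_{αβ} = ∇_(α u_β)` of a flow `u`, which is one half of `𝓛_u g`. -/
def expansionTensor (g : MetricField) (u : Coords 4 → Coords 4) (x : Coords 4)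
    (α β : Fin 4) : ℝ :=
  (1 / 2) * lieMetric g u x α β

/-! ## Hypersurfaces and junction conditions

The abstract hypersurface `σ` is described by a coordinate domain `U ⊆ ℝ³`. -/

/-- The tangent vector `e_a = dΦ(∂/∂ξ^a)`, a vector of the ambient space at `Φ p`. -/
def tangentVec (Φ : Coords 3 → Coords 4) (a : Fin 3) (p : Coords 3) : Coords 4 :=
  fun μ => pderiv a (fun q => Φ q μ) p

/-- The first fundamental form `e_a^μ e_b^ν g_{μν}` of the hypersurface. -/
def firstForm (g : MetricField) (Φ : Coords 3 → Coords 4) (p : Coords 3) (a b : Fin 3) : ℝ :=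
  gdot (g (Φ p)) (tangentVec Φ a p) (tangentVec Φ b p)

/-- The vector `e_a^μ ∇_μ e_b^ν` along the hypersurface. -/
def covTangent (g : MetricField) (Φ : Coords 3 → Coords 4) (p : Coords 3) (a b : Fin 3) :
    Coords 4 :=
  fun ν => pderiv a (fun q => tangentVec Φ b q ν) p
    + ∑ α, ∑ β, christoffel g (Φ p) ν α β * tangentVec Φ a p α * tangentVec Φ b p β

/-- The generalised second fundamental form `H_{ab} = - ℓ_ν e_a^μ ∇_μ e_b^ν` with respect to a
rigging `ℓ`. -/
def secondForm (g : MetricField) (Φ ℓ : Coords 3 → Coords 4) (p : Coords 3) (a b : Fin 3) : ℝ :=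
  - gdot (g (Φ p)) (ℓ p) (covTangent g Φ p a b)

/-- `Φ` is a `C³` map of rank 3 from `U` to the domain `M`. -/
structure IsHypersurface (U : Set (Coords 3)) (M : Set (Coords 4)) (Φ : Coords 3 → Coords 4) :
    Prop where
  contDiffOn : ContDiffOn ℝ 3 Φ U
  mapsTo : Set.MapsTo Φ U M
  rank_three : ∀ p ∈ U, LinearIndependent ℝ (fun a => tangentVec Φ a p)

/-- `ℓ` is a rigging: at every point it is transversal to the hypersurface. -/
def IsRigging (U : Set (Coords 3)) (Φ ℓ : Coords 3 → Coords 4) : Prop :=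
  ∀ p ∈ U, LinearIndependent ℝ
    (Fin.cons (ℓ p) (fun a => tangentVec Φ a p) : Fin 4 → Coords 4)

/-- Two spacetimes `(M₁, g₁)` and `(M₂, g₂)` are matched across `σ`, embedded by `Φ₁` and `Φ₂`:
the first fundamental forms agree, and for a pair of riggings with the same scalar products with
themselves and with the tangent vectors, the generalised second fundamental forms agree. -/
structure IsMatching (g₁ : MetricField) (M₁ : Set (Coords 4)) (g₂ : MetricField)
    (M₂ : Set (Coords 4)) (U : Set (Coords 3)) (Φ₁ Φ₂ : Coords 3 → Coords 4) : Prop where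
  hyp₁ : IsHypersurface U M₁ Φ₁
  hyp₂ : IsHypersurface U M₂ Φ₂
  preliminary : ∀ p ∈ U, ∀ a b, firstForm g₁ Φ₁ p a b = firstForm g₂ Φ₂ p a b
  second : ∃ ℓ₁ ℓ₂ : Coords 3 → Coords 4,
    IsRigging U Φ₁ ℓ₁ ∧ IsRigging U Φ₂ ℓ₂ ∧
    (∀ p ∈ U, gdot (g₁ (Φ₁ p)) (ℓ₁ p) (ℓ₁ p) = gdot (g₂ (Φ₂ p)) (ℓ₂ p) (ℓ₂ p)) ∧
    (∀ p ∈ U, ∀ a, gdot (g₁ (Φ₁ p)) (ℓ₁ p) (tangentVec Φ₁ a p)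
      = gdot (g₂ (Φ₂ p)) (ℓ₂ p) (tangentVec Φ₂ a p)) ∧
    (∀ p ∈ U, ∀ a b, secondForm g₁ Φ₁ ℓ₁ p a b = secondForm g₂ Φ₂ ℓ₂ p a b)

/-- The hypersurface is nowhere spacelike: every tangent space contains a timelike or null
vector. -/
def IsNonSpacelike (g : MetricField) (U : Set (Coords 3)) (Φ : Coords 3 → Coords 4) : Prop :=
  ∀ p ∈ U, ∃ v : Coords 3, v ≠ 0 ∧ ∑ a, ∑ b, firstForm g Φ p a b * v a * v b ≤ 0

/-! ## Preservation of the cylindrical symmetry -/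

/-- `η` and `ξ` generate an Abelian group acting on `M`, contained in the isometry group with Lie
algebra `𝔤`, and with spacelike two-dimensional orbits at the points of the hypersurface. -/
structure IsAbelianG2 (g : MetricField) (M : Set (Coords 4)) (𝔤 : Set (Coords 4 → Coords 4))
    (U : Set (Coords 3)) (Φ : Coords 3 → Coords 4) (η ξ : Coords 4 → Coords 4) : Prop where
  mem₁ : η ∈ 𝔤
  mem₂ : ξ ∈ 𝔤
  commute : ∀ x ∈ M, VectorField.lieBracket ℝ η ξ x = 0
  spacelike : ∀ p ∈ U, ∀ c d : ℝ, (c, d) ≠ (0, 0) →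
    0 < gdot (g (Φ p)) (c • η (Φ p) + d • ξ (Φ p)) (c • η (Φ p) + d • ξ (Φ p))

/-- The push-forward `dΦ` maps the vector field `γ` on the hypersurface to the restriction of
the vector field `ξ`. -/
def PushesTo (U : Set (Coords 3)) (Φ : Coords 3 → Coords 4) (γ : Coords 3 → Coords 3)
    (ξ : Coords 4 → Coords 4) : Prop :=
  ∀ p ∈ U, ∑ a, γ p a • tangentVec Φ a p = ξ (Φ p)

/-- The axial Killing vector: the third coordinate is the angle `φ` in all metrics below. -/
def axialField : Coords 4 → Coords 4 := fun _ => ![0, 0, 1, 0]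

/-- The matching preserves the cylindrical symmetry: on each side there is an Abelian `G₂` with
spacelike orbits containing the axial symmetry, and two vector fields on `σ` are mapped by both
push-forwards to the generators, the axial Killing vectors being identified. -/
def PreservesCylindricalSymmetry (g₁ : MetricField) (M₁ : Set (Coords 4))
    (𝔤₁ : Set (Coords 4 → Coords 4)) (g₂ : MetricField) (M₂ : Set (Coords 4))
    (𝔤₂ : Set (Coords 4 → Coords 4)) (U : Set (Coords 3)) (Φ₁ Φ₂ : Coords 3 → Coords 4) : Prop :=
  ∃ (ξ₁ ξ₂ : Coords 4 → Coords 4) (γ δ : Coords 3 → Coords 3),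
    IsAbelianG2 g₁ M₁ 𝔤₁ U Φ₁ axialField ξ₁ ∧ IsAbelianG2 g₂ M₂ 𝔤₂ U Φ₂ axialField ξ₂ ∧
    ContDiffOn ℝ 2 γ U ∧ ContDiffOn ℝ 2 δ U ∧
    PushesTo U Φ₁ γ axialField ∧ PushesTo U Φ₂ γ axialField ∧
    PushesTo U Φ₁ δ ξ₁ ∧ PushesTo U Φ₂ δ ξ₂

/-! ## `G₄` on `S₃` LRS spacetimes -/

/-- `Σ(r, k)` for `k = 1, 0, -1`. -/
def sigmaFun (k : ℤ) (r : ℝ) : ℝ :=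
  if k = 1 then Real.sin r else if k = 0 then r else Real.sinh r

/-- `F(r, k)` for `k = 1, 0, -1`. -/
def fFun (k : ℤ) (r : ℝ) : ℝ :=
  if k = 1 then - Real.cos r else if k = 0 then r ^ 2 / 2 else Real.cosh r

/-- The data of a `G₄` on `S₃` locally rotationally symmetric spacetime. -/
structure LRSSpacetime where
  /-- the range of the time coordinate, an open interval -/
  times : Set ℝ
  isOpen_times : IsOpen times
  ordConnected_times : times.OrdConnected
  a : ℝ → ℝ
  b : ℝ → ℝ
  contDiffOn_a : ContDiffOn ℝ 2 a times
  contDiffOn_b : ContDiffOn ℝ 2 b times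
  a_pos : ∀ t ∈ times, 0 < a t
  b_pos : ∀ t ∈ times, 0 < b t
  ε : ℤ
  n : ℤ
  k : ℤ
  ε_mem : ε = 0 ∨ ε = 1
  n_mem : n = 0 ∨ n = 1
  k_mem : k = -1 ∨ k = 0 ∨ k = 1
  ε_mul_n : ε * n = 0
  ε_mul_k : ε * k = 0

namespace LRSSpacetime

/-- The domain of the coordinates `(t, r, φ, z)`. -/
def domain (L : LRSSpacetime) : Set (Coords 4) :=
  {x | x 0 ∈ L.times ∧ 0 < x 1 ∧ (L.k = 1 → x 1 < Real.pi)}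

/-- The metric
`ds² = -dt² + a(t)² (dz + n (F(r,k) + k) dφ)² + b(t)² [(dr - ε r dz)² + Σ(r,k)² dφ²]`
in the coordinates `(t, r, φ, z)`. -/
def metric (L : LRSSpacetime) : MetricField := fun x =>
  let t := x 0
  let r := x 1
  let dt : Coords 4 := ![1, 0, 0, 0]
  let θ : Coords 4 := ![0, 0, L.n * (fFun L.k r + L.k), 1]
  let ω : Coords 4 := ![0, 1, 0, - (L.ε * r)]
  let dφ : Coords 4 := ![0, 0, 1, 0]
  (-1 : ℝ) • Matrix.vecMulVec dt dt + L.a t ^ 2 • Matrix.vecMulVec θ θ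
    + L.b t ^ 2 • (Matrix.vecMulVec ω ω + sigmaFun L.k r ^ 2 • Matrix.vecMulVec dφ dφ)

/-- The generators of the isometry group on `S₃`: the Killing vector fields tangent to the
hypersurfaces `t = const`. -/
def isometriesOnS3 (L : LRSSpacetime) : Set (Coords 4 → Coords 4) :=
  {ξ | IsKilling L.metric L.domain ξ ∧ ∀ x ∈ L.domain, ξ x 0 = 0}

/-- The set of times `t` which occur on the hypersurface. -/
def timesOn (_L : LRSSpacetime) (U : Set (Coords 3)) (Φ : Coords 3 → Coords 4) : Set ℝ :=
  (fun p => Φ p 0) '' U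

/-- The spacetime is static during the times of `s`: neither `a` nor `b` evolves. -/
def IsStaticOn (L : LRSSpacetime) (s : Set ℝ) : Prop :=
  ∃ a₀ b₀ : ℝ, ∀ t ∈ s, L.a t = a₀ ∧ L.b t = b₀

end LRSSpacetime

/-- The metric `ds² = -dt² + β² dz² + b(t)² [(dr - ε r dz)² + Σ(r,k)² dφ²]` in the coordinates
`(t, r, φ, z)`. -/
def nonExpandingMetric (β : ℝ) (b : ℝ → ℝ) (ε k : ℤ) : MetricField := fun x =>
  let t := x 0
  let r := x 1
  let dt : Coords 4 := ![1, 0, 0, 0]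
  let dz : Coords 4 := ![0, 0, 0, 1]
  let ω : Coords 4 := ![0, 1, 0, - (ε * r)]
  let dφ : Coords 4 := ![0, 0, 1, 0]
  (-1 : ℝ) • Matrix.vecMulVec dt dt + β ^ 2 • Matrix.vecMulVec dz dz
    + b t ^ 2 • (Matrix.vecMulVec ω ω + sigmaFun k r ^ 2 • Matrix.vecMulVec dφ dφ)

/-! ## Static orthogonally transitive cylindrically symmetric spacetimes -/

/-- The data of a static orthogonally transitive cylindrically symmetric spacetime with metric
`-A² dT² + B² dρ² + C² dφ² + D² dz² + 2 E dφ dz`, all coefficients being functions of `ρ`. -/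
structure StaticCylindricalSpacetime where
  /-- the range of the coordinate `ρ`, an open interval -/
  radii : Set ℝ
  isOpen_radii : IsOpen radii
  ordConnected_radii : radii.OrdConnected
  A : ℝ → ℝ
  B : ℝ → ℝ
  C : ℝ → ℝ
  D : ℝ → ℝ
  E : ℝ → ℝ
  contDiffOn_A : ContDiffOn ℝ 2 A radii
  contDiffOn_B : ContDiffOn ℝ 2 B radii
  contDiffOn_C : ContDiffOn ℝ 2 C radii
  contDiffOn_D : ContDiffOn ℝ 2 D radii
  contDiffOn_E : ContDiffOn ℝ 2 E radii
  A_pos : ∀ ρ ∈ radii, 0 < A ρ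
  B_pos : ∀ ρ ∈ radii, 0 < B ρ
  C_pos : ∀ ρ ∈ radii, 0 < C ρ
  D_pos : ∀ ρ ∈ radii, 0 < D ρ
  det_pos : ∀ ρ ∈ radii, 0 < C ρ ^ 2 * D ρ ^ 2 - E ρ ^ 2

namespace StaticCylindricalSpacetime

/-- The domain of the coordinates `(T, ρ, φ, z)`. -/
def domain (S : StaticCylindricalSpacetime) : Set (Coords 4) := {x | x 1 ∈ S.radii}

/-- The metric in the coordinates `(T, ρ, φ, z)`. -/
def metric (S : StaticCylindricalSpacetime) : MetricField := fun x =>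
  !![-(S.A (x 1) ^ 2), 0, 0, 0;
     0, S.B (x 1) ^ 2, 0, 0;
     0, 0, S.C (x 1) ^ 2, S.E (x 1);
     0, 0, S.E (x 1), S.D (x 1) ^ 2]

/-- The generators of the Abelian group `G₃` on `T₃`: the linear combinations with constant
coefficients of the Killing vector fields `∂/∂T`, `∂/∂φ`, `∂/∂z`. -/
def isometriesG3 (_S : StaticCylindricalSpacetime) : Set (Coords 4 → Coords 4) :=
  {ξ | ∃ c a b : ℝ, ξ = fun _ => ![c, 0, a, b]}

end StaticCylindricalSpacetime

end

end CylMatching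

/-!
The matching conditions identify the tangent spaces of the two spacetimes at each point `p` of the
hypersurface by the linear isometry which maps one rigging to the other and `dΦ⁺(∂_a)` to
`dΦ⁻(∂_a)`. For Killing fields `η`, `ξ` tangent to the hypersurface, `-ℓ · ∇_η ξ` is, in coordinates
adapted to both fields, half the derivative of `η · ξ` along the rigging `ℓ`. Hence equality of the
second fundamental forms gives equality of the transversal derivatives of the products of the
generators of the cylindrical symmetry, and equality of the first fundamental forms gives equality
of the tangential ones: the isometry identifies the gradients of these products
(`IsMatching.exists_vector`).

On the static side all the products are functions of `ρ`, so that the timelike vector `∂_T`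
annihilates their gradients. Consequently a timelike vector `X` of the LRS spacetime annihilates the
gradients of the corresponding products there (`exists_stationary_direction`), and `X^t ≠ 0`. The
Killing equations show that the second generator on the LRS side is a combination of `∂_φ` and
`∂_z` with constant coefficients, the latter one nonzero (`LRSSpacetime.exists_eq_const`), so `X`
annihilates the gradients of `g_φφ`, `g_φz` and `g_zz`.

The scale factor `a²` is `g_zz` if `ε = 0`, and `g_zz - g_φφ` if `ε = 1`. Thus `X^t a' = 0` and
`a' = 0`. If `n = 1`, then `g_φz = a² (F + k)` is a function of `r` alone to first order, which gives
`X^r = 0`, and `g_φφ` then gives `b' = 0`. In that case `a` and `b` are constant on the interval of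
the times which occur on the hypersurface, contrary to the assumption that the spacetime is
non-static; so `n = 0`.
-/

namespace CylMatching

/-! ### Partial derivatives -/

theorem pderiv_eq_zero_of_invariant {d : ℕ} (i : Fin d) (f : Coords d → ℝ) (x : Coords d)
    (h : ∀ (y : Coords d) (s : ℝ), f (y + s • Pi.single i (1 : ℝ)) = f y) : pderiv i f x = 0 := by
  unfold pderiv
  by_cases hf : DifferentiableAt ℝ f x
  · rw [← hf.lineDeriv_eq_fderiv, lineDeriv]
    simp [h]
  · simp [fderiv_zero_of_not_differentiableAt hf]

theorem fderiv_apply_eq_sum_pderiv {d : ℕ} (f : Coords d → ℝ) (x v : Coords d) :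
    fderiv ℝ f x v = ∑ i, v i * pderiv i f x := by
  conv_lhs => rw [pi_eq_sum_univ' v, map_sum]
  refine Finset.sum_congr rfl fun i _ => ?_
  rw [map_smul, smul_eq_mul, pderiv]

theorem pderiv_const {d : ℕ} (i : Fin d) (c : ℝ) (x : Coords d) :
    pderiv i (fun _ => c) x = 0 := by
  simp [pderiv]

theorem pderiv_congr {d : ℕ} {U : Set (Coords d)} (hU : IsOpen U) {f h : Coords d → ℝ}
    (hfh : ∀ q ∈ U, f q = h q) (i : Fin d) {p : Coords d} (hp : p ∈ U) :
    pderiv i f p = pderiv i h p := by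
  have : f =ᶠ[nhds p] h := Filter.eventually_of_mem (hU.mem_nhds hp) hfh
  simp only [pderiv, this.fderiv_eq]

theorem pderiv_mul {d : ℕ} (i : Fin d) {f h : Coords d → ℝ} {x : Coords d}
    (hf : DifferentiableAt ℝ f x) (hh : DifferentiableAt ℝ h x) :
    pderiv i (fun y => f y * h y) x = pderiv i f x * h x + f x * pderiv i h x := by
  simp only [pderiv, fderiv_fun_mul hf hh]
  simp
  ring

theorem pderiv_sum {d : ℕ} {ι : Type*} (s : Finset ι) (i : Fin d) {f : ι → Coords d → ℝ}
    {x : Coords d} (hf : ∀ j ∈ s, DifferentiableAt ℝ (f j) x) :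
    pderiv i (fun y => ∑ j ∈ s, f j y) x = ∑ j ∈ s, pderiv i (f j) x := by
  simp only [pderiv, fderiv_fun_sum hf]
  simp

/-- The chain rule along a map into the four-dimensional coordinate domain. -/
theorem pderiv_comp {f : Coords 4 → ℝ} {Φ : Coords 3 → Coords 4} {p : Coords 3} (a : Fin 3)
    (hf : DifferentiableAt ℝ f (Φ p)) (hΦ : DifferentiableAt ℝ Φ p) :
    pderiv a (fun q => f (Φ q)) p = ∑ μ, tangentVec Φ a p μ * pderiv μ f (Φ p) := by
  rw [← fderiv_apply_eq_sum_pderiv]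
  have h : (fun q => f (Φ q)) = f ∘ Φ := rfl
  rw [pderiv, h, fderiv_comp p hf hΦ, ContinuousLinearMap.comp_apply]
  congr 1
  ext μ
  rw [tangentVec, pderiv, fderiv_apply hΦ]
  rfl

/-! ### The derivative of the metric on Killing directions -/

theorem gdot_eq_sum (g : Matrix (Fin 4) (Fin 4) ℝ) (u v : Coords 4) :
    gdot g u v = ∑ α, ∑ β, g α β * u α * v β := by
  simp only [gdot, dotProduct, Matrix.mulVec, Finset.mul_sum]
  exact Finset.sum_congr rfl fun α _ => Finset.sum_congr rfl fun β _ => by ring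

theorem gdot_sum_right {ι : Type*} (s : Finset ι) (g : Matrix (Fin 4) (Fin 4) ℝ) (u : Coords 4)
    (v : ι → Coords 4) : gdot g u (∑ i ∈ s, v i) = ∑ i ∈ s, gdot g u (v i) := by
  simp [gdot, Matrix.mulVec_sum, dotProduct_sum]

theorem gdot_smul_right (g : Matrix (Fin 4) (Fin 4) ℝ) (u v : Coords 4) (c : ℝ) :
    gdot g u (c • v) = c * gdot g u v := by
  simp [gdot, Matrix.mulVec_smul, dotProduct_smul]

theorem gdot_sum_left {ι : Type*} (s : Finset ι) (g : Matrix (Fin 4) (Fin 4) ℝ) (v : Coords 4)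
    (u : ι → Coords 4) : gdot g (∑ i ∈ s, u i) v = ∑ i ∈ s, gdot g (u i) v := by
  simp [gdot, sum_dotProduct]

theorem gdot_smul_left (g : Matrix (Fin 4) (Fin 4) ℝ) (u v : Coords 4) (c : ℝ) :
    gdot g (c • u) v = c * gdot g u v := by
  simp [gdot, smul_dotProduct]

theorem gdot_comm {g : Matrix (Fin 4) (Fin 4) ℝ} (hg : g.IsSymm) (u v : Coords 4) :
    gdot g u v = gdot g v u := by
  simp only [gdot]
  rw [dotProduct_comm, ← Matrix.dotProduct_transpose_mulVec, hg.eq, dotProduct_comm]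

/-- The derivative `X^ν u^α v^β ∂_ν g_{αβ}` in the direction of `X` of the scalar product of two
vector fields with constant components `u` and `v`. -/
noncomputable def metricDeriv (g : MetricField) (x X u v : Coords 4) : ℝ :=
  ∑ ν, X ν * ∑ α, ∑ β, u α * v β * pderiv ν (fun y => g y α β) x

theorem metricDeriv_sum {ι : Type*} (s : Finset ι) (g : MetricField) (x u v : Coords 4)
    (X : ι → Coords 4) :
    metricDeriv g x (∑ i ∈ s, X i) u v = ∑ i ∈ s, metricDeriv g x (X i) u v := by
  simp only [metricDeriv, Finset.sum_apply, Finset.sum_mul]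
  exact Finset.sum_comm

theorem metricDeriv_smul (g : MetricField) (x X u v : Coords 4) (c : ℝ) :
    metricDeriv g x (c • X) u v = c * metricDeriv g x X u v := by
  simp only [metricDeriv, Pi.smul_apply, smul_eq_mul, Finset.mul_sum, mul_assoc]

/-- The components `∇_u v` of the covariant derivative of vectors with constant components. -/
noncomputable def christoffelVec (g : MetricField) (x u v : Coords 4) : Coords 4 :=
  fun ν => ∑ α, ∑ β, christoffel g x ν α β * u α * v β

/-- For constant-component fields `u`, `v` along which the metric components do not change,
`ℓ · ∇_u v = -½ ℓ(u · v)`. -/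
theorem gdot_christoffelVec {g : MetricField} {x : Coords 4} (hdet : IsUnit (g x).det)
    (ℓ : Coords 4) {u v : Coords 4}
    (hu : ∀ α β, ∑ ν, u ν * pderiv ν (fun y => g y α β) x = 0)
    (hv : ∀ α β, ∑ ν, v ν * pderiv ν (fun y => g y α β) x = 0) :
    gdot (g x) ℓ (christoffelVec g x u v) = - (1 / 2) * metricDeriv g x ℓ u v := by
  have key : christoffelVec g x u v = (g x)⁻¹ *ᵥ
      (fun ν => - (1 / 2) * ∑ α, ∑ β, u α * v β * pderiv ν (fun y => g y α β) x) := by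
    ext μ
    simp only [christoffelVec, christoffel, Matrix.mulVec, dotProduct]
    have h1 : ∀ ν, ∑ α, ∑ β, (g x)⁻¹ μ ν * pderiv α (fun y => g y ν β) x * u α * v β = 0 := by
      intro ν
      rw [Finset.sum_comm]
      refine Finset.sum_eq_zero fun β _ => ?_
      have := hu ν β
      calc _ = (g x)⁻¹ μ ν * v β * ∑ α, u α * pderiv α (fun y => g y ν β) x := by
            rw [Finset.mul_sum]; exact Finset.sum_congr rfl fun α _ => by ring
        _ = 0 := by rw [this, mul_zero]
    have h2 : ∀ ν, ∑ α, ∑ β, (g x)⁻¹ μ ν * pderiv β (fun y => g y ν α) x * u α * v β = 0 := by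
      intro ν
      refine Finset.sum_eq_zero fun α _ => ?_
      have := hv ν α
      calc _ = (g x)⁻¹ μ ν * u α * ∑ β, v β * pderiv β (fun y => g y ν α) x := by
            rw [Finset.mul_sum]; exact Finset.sum_congr rfl fun β _ => by ring
        _ = 0 := by rw [this, mul_zero]
    calc _ = ∑ ν, ((1 / 2) *
            ∑ α, ∑ β, (g x)⁻¹ μ ν * pderiv α (fun y => g y ν β) x * u α * v β
          + (1 / 2) * ∑ α, ∑ β, (g x)⁻¹ μ ν * pderiv β (fun y => g y ν α) x * u α * v β
          - (1 / 2) * ∑ α, ∑ β, (g x)⁻¹ μ ν * pderiv ν (fun y => g y α β) x * u α * v β) := by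
          simp only [Fin.sum_univ_four]; ring
      _ = _ := by
          simp only [h1, h2]
          refine Finset.sum_congr rfl fun ν _ => ?_
          simp only [Finset.mul_sum, mul_zero, zero_add, zero_sub, ← Finset.sum_neg_distrib]
          exact Finset.sum_congr rfl fun α _ => Finset.sum_congr rfl fun β _ => by ring
  rw [key, gdot, Matrix.mulVec_mulVec, Matrix.mul_nonsing_inv _ hdet, Matrix.one_mulVec,
    metricDeriv, dotProduct, Finset.mul_sum]
  exact Finset.sum_congr rfl fun ν _ => by ring

/-! ### Symmetric directions along a hypersurface -/

theorem IsHypersurface.differentiableAt {U : Set (Coords 3)} {M : Set (Coords 4)}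
    {Φ : Coords 3 → Coords 4} (h : IsHypersurface U M Φ) (hU : IsOpen U) {p : Coords 3}
    (hp : p ∈ U) : DifferentiableAt ℝ Φ p :=
  (h.contDiffOn.contDiffAt (hU.mem_nhds hp)).differentiableAt (by norm_num)

theorem IsHypersurface.differentiableAt_tangentVec {U : Set (Coords 3)} {M : Set (Coords 4)}
    {Φ : Coords 3 → Coords 4} (h : IsHypersurface U M Φ) (hU : IsOpen U) {p : Coords 3}
    (hp : p ∈ U) (b : Fin 3) (ν : Fin 4) :
    DifferentiableAt ℝ (fun q => tangentVec Φ b q ν) p := by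
  have h3 : ContDiffAt ℝ 3 (fun q => Φ q ν) p :=
    contDiffAt_pi.1 (h.contDiffOn.contDiffAt (hU.mem_nhds hp)) ν
  have h2 : ContDiffAt ℝ 2 (fderiv ℝ (fun q => Φ q ν)) p :=
    h3.fderiv_right (by norm_num)
  exact (h2.differentiableAt (by norm_num)).clm_apply (differentiableAt_const _)

/-- The second fundamental form on vector fields of the hypersurface which are pushed forward to
constant-component fields `u`, `v`. The last term depends on the intrinsic fields and on the
products of the rigging with the tangent vectors only. -/
theorem sum_secondForm {g : MetricField} {U : Set (Coords 3)} (hU : IsOpen U)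
    {M : Set (Coords 4)} {Φ : Coords 3 → Coords 4} (hΦ : IsHypersurface U M Φ)
    (ℓ : Coords 3 → Coords 4) {γ δ : Coords 3 → Coords 3} (hδ : ContDiffOn ℝ 2 δ U)
    {u v : Coords 4}
    (hγu : ∀ p ∈ U, ∑ a, γ p a • tangentVec Φ a p = u)
    (hδv : ∀ p ∈ U, ∑ a, δ p a • tangentVec Φ a p = v) {p : Coords 3} (hp : p ∈ U) :
    ∑ a, ∑ b, γ p a * δ p b * secondForm g Φ ℓ p a b =
      - gdot (g (Φ p)) (ℓ p) (christoffelVec g (Φ p) u v)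
      + ∑ a, ∑ b, γ p a * pderiv a (fun q => δ q b) p
          * gdot (g (Φ p)) (ℓ p) (tangentVec Φ b p) := by
  have hδd : ∀ b, DifferentiableAt ℝ (fun q => δ q b) p := fun b =>
    (contDiffAt_pi.1 (hδ.contDiffAt (hU.mem_nhds hp)) b).differentiableAt (by norm_num)
  -- The Leibniz rule applied to the constant `δ^b e_b = v`.
  have hleib : ∀ a ν, ∑ b, δ p b * pderiv a (fun q => tangentVec Φ b q ν) p
      = - ∑ b, pderiv a (fun q => δ q b) p * tangentVec Φ b p ν := by
    intro a ν
    have h0 : pderiv a (fun q => ∑ b, δ q b * tangentVec Φ b q ν) p = 0 := by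
      rw [pderiv_congr hU (h := fun _ => v ν) _ a hp, pderiv_const]
      intro q hq
      rw [← hδv q hq]
      simp
    rw [pderiv_sum _ _ fun b _ => (hδd b).fun_mul (hΦ.differentiableAt_tangentVec hU hp b ν)] at h0
    simp only [fun b => pderiv_mul a (hδd b) (hΦ.differentiableAt_tangentVec hU hp b ν),
      Finset.sum_add_distrib] at h0
    linarith
  have hu : ∀ α, ∑ a, γ p a * tangentVec Φ a p α = u α := fun α => by
    rw [← hγu p hp]; simp
  have hv : ∀ α, ∑ a, δ p a * tangentVec Φ a p α = v α := fun α => by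
    rw [← hδv p hp]; simp
  have hcov : ∑ a, ∑ b, (γ p a * δ p b) • covTangent g Φ p a b
      = christoffelVec g (Φ p) u v
        - ∑ a, ∑ b, (γ p a * pderiv a (fun q => δ q b) p) • tangentVec Φ b p := by
    ext ν
    have e1 : ∑ a, ∑ b, γ p a * δ p b * pderiv a (fun q => tangentVec Φ b q ν) p
        = - ∑ a, ∑ b, γ p a * pderiv a (fun q => δ q b) p * tangentVec Φ b p ν := by
      rw [← Finset.sum_neg_distrib]
      refine Finset.sum_congr rfl fun a _ => ?_
      simp only [mul_assoc]
      rw [← Finset.mul_sum, hleib, ← Finset.mul_sum, mul_neg]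
    have e2 : ∑ a, ∑ b, γ p a * δ p b *
        (∑ α, ∑ β, christoffel g (Φ p) ν α β * tangentVec Φ a p α * tangentVec Φ b p β)
        = christoffelVec g (Φ p) u v ν := by
      simp only [christoffelVec, ← hu, ← hv]
      simp only [Fin.sum_univ_three, Fin.sum_univ_four]
      ring
    simp only [Finset.sum_apply, Pi.smul_apply, smul_eq_mul, Pi.sub_apply, covTangent, mul_add,
      Finset.sum_add_distrib]
    rw [e1, e2]
    ring
  have hlhs : ∑ a, ∑ b, γ p a * δ p b * secondForm g Φ ℓ p a b
      = - gdot (g (Φ p)) (ℓ p) (∑ a, ∑ b, (γ p a * δ p b) • covTangent g Φ p a b) := by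
    simp only [gdot_sum_right, gdot_smul_right, secondForm, mul_neg, Finset.sum_neg_distrib]
  have hsub : ∀ x y : Coords 4, gdot (g (Φ p)) (ℓ p) (x - y)
      = gdot (g (Φ p)) (ℓ p) x - gdot (g (Φ p)) (ℓ p) y := fun x y => by
    simp [gdot, Matrix.mulVec_sub, dotProduct_sub]
  rw [hlhs, hcov, hsub]
  simp only [gdot_sum_right, gdot_smul_right]
  ring

/-- Along the hypersurface, the tangential derivatives of the product `u · v` are the intrinsic
derivatives of the first fundamental form on the fields `γ`, `δ` which are pushed forward to `u`,
`v`. -/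
theorem metricDeriv_tangentVec {g : MetricField} {U : Set (Coords 3)} (hU : IsOpen U)
    {M : Set (Coords 4)} {Φ : Coords 3 → Coords 4} (hΦ : IsHypersurface U M Φ)
    (hg : ∀ x ∈ M, ∀ α β, DifferentiableAt ℝ (fun y => g y α β) x)
    {γ δ : Coords 3 → Coords 3} {u v : Coords 4}
    (hγu : ∀ p ∈ U, ∑ a, γ p a • tangentVec Φ a p = u)
    (hδv : ∀ p ∈ U, ∑ a, δ p a • tangentVec Φ a p = v) {p : Coords 3} (hp : p ∈ U)
    (c : Fin 3) :
    metricDeriv g (Φ p) (tangentVec Φ c p) u v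
      = pderiv c (fun q => ∑ a, ∑ b, γ q a * δ q b * firstForm g Φ q a b) p := by
  have hd := hg _ (hΦ.mapsTo hp)
  have hΦd := hΦ.differentiableAt hU hp
  have h1 : ∀ q ∈ U, ∑ a, ∑ b, γ q a * δ q b * firstForm g Φ q a b
      = ∑ α, ∑ β, (u α * v β) * g (Φ q) α β := by
    intro q hq
    have : gdot (g (Φ q)) u v = ∑ a, ∑ b, γ q a * δ q b * firstForm g Φ q a b := by
      conv_lhs => rw [← hγu q hq, ← hδv q hq]
      simp only [gdot_sum_left, gdot_sum_right, gdot_smul_left, gdot_smul_right, firstForm,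
        Finset.mul_sum]
      rw [Finset.sum_comm]
      exact Finset.sum_congr rfl fun a _ => Finset.sum_congr rfl fun b _ => by ring
    rw [← this, gdot_eq_sum]
    exact Finset.sum_congr rfl fun α _ => Finset.sum_congr rfl fun β _ => by ring
  rw [pderiv_congr hU h1 c hp]
  have hgd : ∀ α β, DifferentiableAt ℝ (fun q => g (Φ q) α β) p := fun α β =>
    (hd α β).comp p hΦd
  have hcd : ∀ α β, DifferentiableAt ℝ (fun q => u α * v β * g (Φ q) α β) p := fun α β =>
    (differentiableAt_const _).fun_mul (hgd α β)
  rw [pderiv_sum _ _ fun α _ => DifferentiableAt.fun_sum fun β _ => hcd α β]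
  simp only [fun α => pderiv_sum Finset.univ c fun β _ => hcd α β,
    fun α β => pderiv_mul c (differentiableAt_const (u α * v β)) (hgd α β), pderiv_const,
    fun α β => pderiv_comp c (hd α β) hΦd, zero_mul, zero_add, metricDeriv, Finset.mul_sum]
  rw [Finset.sum_comm]
  refine Finset.sum_congr rfl fun α _ => ?_
  rw [Finset.sum_comm]
  exact Finset.sum_congr rfl fun β _ => Finset.sum_congr rfl fun ν _ => by ring

/-- In a matching, the gradients of the products of symmetric fields are identified, together with
the scalar product, by the isomorphism of the ambient tangent spaces which maps the rigging and the
tangent vectors to each other. -/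
theorem IsMatching.exists_vector {g₁ g₂ : MetricField} {M₁ M₂ : Set (Coords 4)}
    {U : Set (Coords 3)} {Φ₁ Φ₂ : Coords 3 → Coords 4} (hU : IsOpen U)
    (h : IsMatching g₁ M₁ g₂ M₂ U Φ₁ Φ₂)
    (hsymm₁ : ∀ x ∈ M₁, (g₁ x).IsSymm) (hsymm₂ : ∀ x ∈ M₂, (g₂ x).IsSymm)
    (hdet₁ : ∀ x ∈ M₁, IsUnit (g₁ x).det) (hdet₂ : ∀ x ∈ M₂, IsUnit (g₂ x).det)
    (hd₁ : ∀ x ∈ M₁, ∀ α β, DifferentiableAt ℝ (fun y => g₁ y α β) x)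
    (hd₂ : ∀ x ∈ M₂, ∀ α β, DifferentiableAt ℝ (fun y => g₂ y α β) x)
    {ι : Type*} {γ : ι → Coords 3 → Coords 3} (hγ : ∀ i, ContDiffOn ℝ 2 (γ i) U)
    {u₁ u₂ : ι → Coords 4}
    (hu₁ : ∀ i, ∀ p ∈ U, ∑ a, γ i p a • tangentVec Φ₁ a p = u₁ i)
    (hu₂ : ∀ i, ∀ p ∈ U, ∑ a, γ i p a • tangentVec Φ₂ a p = u₂ i)
    (hinv₁ : ∀ i, ∀ x ∈ M₁, ∀ α β, ∑ ν, u₁ i ν * pderiv ν (fun y => g₁ y α β) x = 0)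
    (hinv₂ : ∀ i, ∀ x ∈ M₂, ∀ α β, ∑ ν, u₂ i ν * pderiv ν (fun y => g₂ y α β) x = 0)
    {p : Coords 3} (hp : p ∈ U) (X₂ : Coords 4) :
    ∃ X₁ : Coords 4, gdot (g₁ (Φ₁ p)) X₁ X₁ = gdot (g₂ (Φ₂ p)) X₂ X₂ ∧
      ∀ i j, metricDeriv g₁ (Φ₁ p) X₁ (u₁ i) (u₁ j)
        = metricDeriv g₂ (Φ₂ p) X₂ (u₂ i) (u₂ j) := by
  obtain ⟨ℓ₁, ℓ₂, -, hr₂, hll, hle, hII⟩ := h.second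
  have hx₁ := h.hyp₁.mapsTo hp
  have hx₂ := h.hyp₂.mapsTo hp
  set e₁ : Fin 4 → Coords 4 := Fin.cons (ℓ₁ p) (fun a => tangentVec Φ₁ a p) with he₁
  set e₂ : Fin 4 → Coords 4 := Fin.cons (ℓ₂ p) (fun a => tangentVec Φ₂ a p) with he₂
  obtain ⟨c, hc⟩ : ∃ c : Fin 4 → ℝ, ∑ i, c i • e₂ i = X₂ := by
    have hspan := (hr₂ p hp).span_eq_top_of_card_eq_finrank' (by simp)
    have hX : X₂ ∈ Submodule.span ℝ (Set.range e₂) := by rw [he₂, hspan]; trivial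
    exact (Submodule.mem_span_range_iff_exists_fun ℝ).1 hX
  have hgram : ∀ i j, gdot (g₁ (Φ₁ p)) (e₁ i) (e₁ j) = gdot (g₂ (Φ₂ p)) (e₂ i) (e₂ j) := by
    intro i j
    refine Fin.cases ?_ (fun a => ?_) i <;> refine Fin.cases ?_ (fun b => ?_) j
    · simpa [he₁, he₂] using hll p hp
    · simpa [he₁, he₂] using hle p hp b
    · simp only [he₁, he₂, Fin.cons_zero, Fin.cons_succ]
      rw [gdot_comm (hsymm₁ _ hx₁), gdot_comm (hsymm₂ _ hx₂)]
      exact hle p hp a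
    · simpa [he₁, he₂, firstForm] using h.preliminary p hp a b
  have hgrad : ∀ m i j, metricDeriv g₁ (Φ₁ p) (e₁ m) (u₁ i) (u₁ j)
      = metricDeriv g₂ (Φ₂ p) (e₂ m) (u₂ i) (u₂ j) := by
    intro m i j
    refine Fin.cases ?_ (fun a => ?_) m
    · simp only [he₁, he₂, Fin.cons_zero]
      have s₁ := sum_secondForm (g := g₁) hU h.hyp₁ ℓ₁ (hγ j) (hu₁ i) (hu₁ j) hp
      have s₂ := sum_secondForm (g := g₂) hU h.hyp₂ ℓ₂ (hγ j) (hu₂ i) (hu₂ j) hp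
      rw [gdot_christoffelVec (hdet₁ _ hx₁) _ (hinv₁ i _ hx₁) (hinv₁ j _ hx₁)] at s₁
      rw [gdot_christoffelVec (hdet₂ _ hx₂) _ (hinv₂ i _ hx₂) (hinv₂ j _ hx₂)] at s₂
      simp only [hII p hp, hle p hp] at s₁
      linarith
    · simp only [he₁, he₂, Fin.cons_succ]
      rw [metricDeriv_tangentVec hU h.hyp₁ hd₁ (hu₁ i) (hu₁ j) hp,
        metricDeriv_tangentVec hU h.hyp₂ hd₂ (hu₂ i) (hu₂ j) hp]
      refine pderiv_congr hU (fun q hq => ?_) a hp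
      simp only [h.preliminary q hq]
  refine ⟨∑ i, c i • e₁ i, ?_, fun i j => ?_⟩
  · rw [← hc]
    simp only [gdot_sum_left, gdot_sum_right, gdot_smul_left, gdot_smul_right, hgram]
  · rw [← hc]
    simp only [metricDeriv_sum, metricDeriv_smul, hgrad]

/-! ### The components of the two metrics -/

/-- Partial derivatives of a sum of two terms with separated variables `x⁰` and `x¹`; all metric
components of a locally rotationally symmetric spacetime have this form. -/
theorem pderiv_separated {f₁ f₂ h₁ h₂ : ℝ → ℝ} {f₁' f₂' h₁' h₂' : ℝ} {x : Coords 4}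
    (hf₁ : HasDerivAt f₁ f₁' (x 0)) (hf₂ : HasDerivAt f₂ f₂' (x 0))
    (hh₁ : HasDerivAt h₁ h₁' (x 1)) (hh₂ : HasDerivAt h₂ h₂' (x 1)) :
    pderiv 0 (fun y : Coords 4 => f₁ (y 0) * h₁ (y 1) + f₂ (y 0) * h₂ (y 1)) x
        = f₁' * h₁ (x 1) + f₂' * h₂ (x 1) ∧
      pderiv 1 (fun y : Coords 4 => f₁ (y 0) * h₁ (y 1) + f₂ (y 0) * h₂ (y 1)) x
        = f₁ (x 0) * h₁' + f₂ (x 0) * h₂' := by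
  have hx : ∀ i : Fin 4, HasFDerivAt (fun y : Coords 4 => y i)
      (ContinuousLinearMap.proj (R := ℝ) (φ := fun _ : Fin 4 => ℝ) i) x := fun i =>
    hasFDerivAt_apply i x
  have h := ((hf₁.comp_hasFDerivAt x (hx 0)).mul (hh₁.comp_hasFDerivAt x (hx 1))).add
    ((hf₂.comp_hasFDerivAt x (hx 0)).mul (hh₂.comp_hasFDerivAt x (hx 1)))
  have h' : fderiv ℝ (fun y : Coords 4 => f₁ (y 0) * h₁ (y 1) + f₂ (y 0) * h₂ (y 1)) x = _ :=
    h.fderiv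
  constructor
  · simp [pderiv, h']
    ring
  · simp [pderiv, h']

theorem contDiff_sigmaFun (k : ℤ) : ContDiff ℝ 2 (sigmaFun k) := by
  unfold sigmaFun
  split_ifs
  · exact Real.contDiff_sin
  · exact contDiff_id
  · exact Real.contDiff_sinh

/-- `F' = Σ`. -/
theorem hasDerivAt_fFun (k : ℤ) (r : ℝ) : HasDerivAt (fFun k) (sigmaFun k r) r := by
  unfold fFun sigmaFun
  split_ifs
  · simpa using (Real.hasDerivAt_cos r).fun_neg
  · have := (hasDerivAt_pow 2 r).div_const 2
    simpa using this
  · exact Real.hasDerivAt_cosh r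

theorem hasDerivAt_sigmaFun (k : ℤ) (r : ℝ) :
    HasDerivAt (sigmaFun k) (deriv (sigmaFun k) r) r :=
  (((contDiff_sigmaFun k).differentiable (by norm_num)) r).hasDerivAt

theorem sigmaFun_pos {k : ℤ} {r : ℝ} (hr : 0 < r) (hk : k = 1 → r < Real.pi) :
    0 < sigmaFun k r := by
  unfold sigmaFun
  split_ifs with h1 h2
  · exact Real.sin_pos_of_pos_of_lt_pi hr (hk h1)
  · exact hr
  · exact Real.sinh_pos_iff.2 hr

namespace LRSSpacetime

variable (L : LRSSpacetime)

theorem metric_eq (x : Coords 4) : L.metric x =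
    !![-1, 0, 0, 0;
       0, L.b (x 0) ^ 2, 0, -(L.b (x 0) ^ 2 * (L.ε * x 1));
       0, 0, L.a (x 0) ^ 2 * (L.n * (fFun L.k (x 1) + L.k)) ^ 2
          + L.b (x 0) ^ 2 * sigmaFun L.k (x 1) ^ 2, L.a (x 0) ^ 2 * (L.n * (fFun L.k (x 1) + L.k));
       0, -(L.b (x 0) ^ 2 * (L.ε * x 1)), L.a (x 0) ^ 2 * (L.n * (fFun L.k (x 1) + L.k)),
          L.a (x 0) ^ 2 + L.b (x 0) ^ 2 * (L.ε * x 1) ^ 2] := by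
  ext i j
  fin_cases i <;> fin_cases j <;>
    simp [metric, -mul_eq_mul_left_iff] <;> ring

theorem metric_isSymm (x : Coords 4) : (L.metric x).IsSymm := by
  rw [metric_eq]
  ext i j
  fin_cases i <;> fin_cases j <;> simp

theorem isOpen_domain : IsOpen L.domain := by
  have h : L.domain = {x | x 0 ∈ L.times} ∩ ({x | 0 < x 1} ∩ {x | L.k = 1 → x 1 < Real.pi}) := rfl
  rw [h]
  refine (L.isOpen_times.preimage (continuous_apply 0)).inter
    ((isOpen_lt continuous_const (continuous_apply 1)).inter ?_)
  by_cases hk : L.k = 1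
  · simpa [hk] using isOpen_lt (continuous_apply (1 : Fin 4)) continuous_const
  · simp [hk]

theorem convex_domain : Convex ℝ L.domain := by
  intro x hx y hy s t hs ht hst
  refine ⟨L.ordConnected_times.convex hx.1 hy.1 hs ht hst,
    (convex_Ioi (0 : ℝ)) hx.2.1 hy.2.1 hs ht hst, fun hk => ?_⟩
  exact (convex_Iio Real.pi) (hx.2.2 hk) (hy.2.2 hk) hs ht hst

variable {L}

theorem hasDerivAt_a {t : ℝ} (ht : t ∈ L.times) : HasDerivAt L.a (deriv L.a t) t :=
  ((L.contDiffOn_a.contDiffAt (L.isOpen_times.mem_nhds ht)).differentiableAt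
    (by norm_num)).hasDerivAt

theorem hasDerivAt_b {t : ℝ} (ht : t ∈ L.times) : HasDerivAt L.b (deriv L.b t) t :=
  ((L.contDiffOn_b.contDiffAt (L.isOpen_times.mem_nhds ht)).differentiableAt
    (by norm_num)).hasDerivAt

theorem isUnit_det_metric {x : Coords 4} (hx : x ∈ L.domain) : IsUnit (L.metric x).det := by
  have ha := L.a_pos _ hx.1
  have hb := L.b_pos _ hx.1
  have hσ := sigmaFun_pos hx.2.1 hx.2.2
  have h : (L.metric x).det = - (L.a (x 0) ^ 2 * L.b (x 0) ^ 4 * sigmaFun L.k (x 1) ^ 2) := by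
    rw [metric_eq]
    simp [Matrix.det_succ_row_zero, Fin.sum_univ_succ, Fin.succAbove]
    ring
  rw [h, isUnit_iff_ne_zero]
  exact neg_ne_zero.2 (by positivity)

theorem differentiableAt_metric {x : Coords 4} (hx : x ∈ L.domain) (α β : Fin 4) :
    DifferentiableAt ℝ (fun y => L.metric y α β) x := by
  have ha : DifferentiableAt ℝ (fun y : Coords 4 => L.a (y 0)) x :=
    (hasDerivAt_a hx.1).differentiableAt.comp x (differentiableAt_apply 0 x)
  have hb : DifferentiableAt ℝ (fun y : Coords 4 => L.b (y 0)) x :=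
    (hasDerivAt_b hx.1).differentiableAt.comp x (differentiableAt_apply 0 x)
  have hF : DifferentiableAt ℝ (fun y : Coords 4 => fFun L.k (y 1)) x :=
    DifferentiableAt.comp (g := fFun L.k) x (hasDerivAt_fFun L.k (x 1)).differentiableAt (differentiableAt_apply 1 x)
  have hσ : DifferentiableAt ℝ (fun y : Coords 4 => sigmaFun L.k (y 1)) x :=
    DifferentiableAt.comp (g := sigmaFun L.k) x (hasDerivAt_sigmaFun L.k (x 1)).differentiableAt (differentiableAt_apply 1 x)
  simp only [metric_eq]
  fin_cases α <;> fin_cases β <;> simp <;> fun_prop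

theorem pderiv_metric_two (x : Coords 4) (α β : Fin 4) :
    pderiv 2 (fun y => L.metric y α β) x = 0 := by
  refine pderiv_eq_zero_of_invariant _ _ _ fun y s => ?_
  simp [metric_eq]

theorem pderiv_metric_three (x : Coords 4) (α β : Fin 4) :
    pderiv 3 (fun y => L.metric y α β) x = 0 := by
  refine pderiv_eq_zero_of_invariant _ _ _ fun y s => ?_
  simp [metric_eq]

theorem hasDerivAt_twist (r : ℝ) :
    HasDerivAt (fun r => (L.n : ℝ) * (fFun L.k r + L.k)) (L.n * sigmaFun L.k r) r :=
  ((hasDerivAt_fFun L.k r).add_const _).const_mul _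

theorem pderiv_metric_two_two {x : Coords 4} (hx : x ∈ L.domain) :
    pderiv 0 (fun y => L.metric y 2 2) x
        = 2 * L.a (x 0) * deriv L.a (x 0) * (L.n * (fFun L.k (x 1) + L.k)) ^ 2
          + 2 * L.b (x 0) * deriv L.b (x 0) * sigmaFun L.k (x 1) ^ 2 ∧
      pderiv 1 (fun y => L.metric y 2 2) x
        = L.a (x 0) ^ 2 * (2 * (L.n * (fFun L.k (x 1) + L.k)) * (L.n * sigmaFun L.k (x 1)))
          + L.b (x 0) ^ 2 * (2 * sigmaFun L.k (x 1) * deriv (sigmaFun L.k) (x 1)) := by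
  have h := pderiv_separated ((hasDerivAt_a hx.1).fun_pow 2) ((hasDerivAt_b hx.1).fun_pow 2)
    ((hasDerivAt_twist (L := L) (x 1)).fun_pow 2) ((hasDerivAt_sigmaFun L.k (x 1)).fun_pow 2)
  simp only [metric_eq]
  simpa using h

theorem pderiv_metric_two_three {x : Coords 4} (hx : x ∈ L.domain) :
    pderiv 0 (fun y => L.metric y 2 3) x
        = 2 * L.a (x 0) * deriv L.a (x 0) * (L.n * (fFun L.k (x 1) + L.k)) ∧
      pderiv 1 (fun y => L.metric y 2 3) x
        = L.a (x 0) ^ 2 * (L.n * sigmaFun L.k (x 1)) := by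
  have h := pderiv_separated ((hasDerivAt_a hx.1).fun_pow 2) (hasDerivAt_const (x 0) (0 : ℝ))
    (hasDerivAt_twist (L := L) (x 1)) (hasDerivAt_const (x 1) (0 : ℝ))
  simp only [metric_eq]
  simpa using h

theorem pderiv_metric_three_three {x : Coords 4} (hx : x ∈ L.domain) :
    pderiv 0 (fun y => L.metric y 3 3) x
        = 2 * L.a (x 0) * deriv L.a (x 0)
          + 2 * L.b (x 0) * deriv L.b (x 0) * (L.ε * x 1) ^ 2 ∧
      pderiv 1 (fun y => L.metric y 3 3) x
        = L.b (x 0) ^ 2 * (2 * (L.ε * x 1) * L.ε) := by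
  have h := pderiv_separated ((hasDerivAt_a hx.1).fun_pow 2) ((hasDerivAt_b hx.1).fun_pow 2)
    (hasDerivAt_const (x 1) (1 : ℝ))
    (((hasDerivAt_id (x 1)).const_mul (L.ε : ℝ)).fun_pow 2)
  simp only [metric_eq]
  simpa using h

/-- A timelike vector is not tangent to the hypersurfaces `t = const`. -/
theorem time_component_ne_zero {x X : Coords 4} (hX : gdot (L.metric x) X X < 0) : X 0 ≠ 0 := by
  intro h0
  have h : gdot (L.metric x) X X = L.a (x 0) ^ 2 * (X 3 + L.n * (fFun L.k (x 1) + L.k) * X 2) ^ 2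
      + L.b (x 0) ^ 2 * ((X 1 - L.ε * x 1 * X 3) ^ 2 + sigmaFun L.k (x 1) ^ 2 * X 2 ^ 2) := by
    rw [gdot_eq_sum, metric_eq]
    simp [Fin.sum_univ_four, h0]
    ring
  have : 0 ≤ gdot (L.metric x) X X := by rw [h]; positivity
  linarith

end LRSSpacetime

namespace StaticCylindricalSpacetime

variable {S : StaticCylindricalSpacetime}

theorem metric_isSymm (x : Coords 4) : (S.metric x).IsSymm := by
  ext i j
  fin_cases i <;> fin_cases j <;> simp [metric]

theorem isUnit_det_metric {x : Coords 4} (hx : x ∈ S.domain) : IsUnit (S.metric x).det := by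
  have hA := S.A_pos _ hx
  have hB := S.B_pos _ hx
  have hE := S.det_pos _ hx
  have h : (S.metric x).det = - (S.A (x 1) ^ 2 * S.B (x 1) ^ 2
      * (S.C (x 1) ^ 2 * S.D (x 1) ^ 2 - S.E (x 1) ^ 2)) := by
    simp [metric, Matrix.det_succ_row_zero, Fin.sum_univ_succ, Fin.succAbove]
    ring
  rw [h, isUnit_iff_ne_zero]
  exact neg_ne_zero.2 (by positivity)

theorem differentiableAt_metric {x : Coords 4} (hx : x ∈ S.domain) (α β : Fin 4) :
    DifferentiableAt ℝ (fun y => S.metric y α β) x := by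
  have key : ∀ f : ℝ → ℝ, ContDiffOn ℝ 2 f S.radii →
      DifferentiableAt ℝ (fun y : Coords 4 => f (y 1)) x := fun f hf =>
    ((hf.contDiffAt (S.isOpen_radii.mem_nhds hx)).differentiableAt (by norm_num)).comp x
      (differentiableAt_apply 1 x)
  have hA := key _ S.contDiffOn_A
  have hB := key _ S.contDiffOn_B
  have hC := key _ S.contDiffOn_C
  have hD := key _ S.contDiffOn_D
  have hE := key _ S.contDiffOn_E
  simp only [metric]
  fin_cases α <;> fin_cases β <;> simp <;> fun_prop

theorem pderiv_metric {i : Fin 4} (hi : i ≠ 1) (x : Coords 4) (α β : Fin 4) :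
    pderiv i (fun y => S.metric y α β) x = 0 := by
  refine pderiv_eq_zero_of_invariant _ _ _ fun y s => ?_
  simp [metric, hi.symm]

end StaticCylindricalSpacetime

/-! ### Killing fields of locally rotationally symmetric spacetimes -/

namespace LRSSpacetime

variable {L : LRSSpacetime}

/-- A Killing field `ξ` which is tangent to the hypersurfaces `t = const` and commutes with `∂_φ`
has no `r` component: `𝓛_ξ g_φφ = 0` says that `ξ^r ∂_r g_φφ = 0`, and the zeros of `∂_r g_φφ` have
no interior. -/
theorem radial_component_eq_zero {ξ : Coords 4 → Coords 4} (hξ : ξ ∈ L.isometriesOnS3)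
    (hcomm : ∀ x ∈ L.domain, ∀ μ, pderiv 2 (fun y => ξ y μ) x = 0) {x : Coords 4}
    (hx : x ∈ L.domain) : ξ x 1 = 0 := by
  have hprod : ∀ y ∈ L.domain, ξ y 1 * pderiv 1 (fun y => L.metric y 2 2) y = 0 := by
    intro y hy
    have h := hξ.1.2 y hy 2 2
    simpa [lieMetric, Fin.sum_univ_four, hξ.2 y hy, pderiv_metric_two, pderiv_metric_three,
      hcomm y hy] using h
  by_contra hne
  -- Up to the factor `2 Σ`, this is `∂_r g_φφ` on the `r` line through `x`.
  set Q : ℝ → ℝ := fun r => L.a (x 0) ^ 2 * (L.n * (L.n * (fFun L.k r + L.k)))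
    + L.b (x 0) ^ 2 * deriv (sigmaFun L.k) r with hQ
  have hline : ContinuousAt (fun r => Function.update x 1 r) (x 1) :=
    (continuous_const.update 1 continuous_id).continuousAt
  have hup : Function.update x 1 (x 1) = x := Function.update_eq_self 1 x
  have hev : ∀ᶠ r in nhds (x 1), Q r = 0 := by
    have h1 : ∀ᶠ r in nhds (x 1), Function.update x 1 r ∈ L.domain :=
      hline.eventually_mem (by rw [hup]; exact L.isOpen_domain.mem_nhds hx)
    have hc : ContinuousAt (fun y => ξ y 1) x :=
      (continuous_apply 1).continuousAt.comp
        (hξ.1.1.continuousOn.continuousAt (L.isOpen_domain.mem_nhds hx))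
    have h2 : ∀ᶠ r in nhds (x 1), ξ (Function.update x 1 r) 1 ≠ 0 := by
      have hc' : ContinuousAt (fun r => ξ (Function.update x 1 r) 1) (x 1) :=
        ContinuousAt.comp (g := fun y => ξ y 1) (f := fun r => Function.update x 1 r) (by rw [hup]; exact hc) hline
      exact hc'.eventually_ne (by rw [hup]; exact hne)
    filter_upwards [h1, h2] with r hr1 hr2
    have h := (mul_eq_zero.1 (hprod _ hr1)).resolve_left hr2
    rw [(pderiv_metric_two_two hr1).2] at h
    have hσ := sigmaFun_pos hr1.2.1 hr1.2.2
    simp only [Function.update_self, Function.update_of_ne (show (0 : Fin 4) ≠ 1 by decide)]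
      at h hσ
    have : 2 * sigmaFun L.k r * Q r = 0 := by rw [hQ, ← h]; ring
    exact (mul_eq_zero.1 this).resolve_left (by positivity)
  have hb := L.b_pos _ hx.1
  have hr := hx.2.1
  have hQ0 : Q (x 1) = 0 := hev.self_of_nhds
  rcases L.k_mem with hk | hk | hk
  · have hσ : deriv (sigmaFun L.k) = Real.cosh := by
      have : sigmaFun L.k = Real.sinh := by ext r; simp [sigmaFun, hk]
      rw [this, Real.deriv_sinh]
    have h1 := Real.one_le_cosh (x 1)
    have : 0 < Q (x 1) := by
      simp only [hQ, hσ]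
      simp only [fFun, hk]
      norm_num
      have : 0 ≤ Real.cosh (x 1) + -1 := by linarith
      rw [← mul_assoc (L.n : ℝ)]
      have : 0 ≤ (L.n : ℝ) * L.n * (Real.cosh (x 1) + -1) := mul_nonneg (mul_self_nonneg _) this
      positivity
    linarith
  · have hσ : deriv (sigmaFun L.k) = fun _ => 1 := by
      have : sigmaFun L.k = fun r => r := by ext r; simp [sigmaFun, hk]
      rw [this]; ext r; simp
    have : 0 < Q (x 1) := by
      simp only [hQ, hσ]
      simp only [fFun, hk]
      norm_num
      rw [← mul_assoc (L.n : ℝ)]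
      have : 0 ≤ (L.n : ℝ) * L.n * (x 1 ^ 2 / 2) :=
        mul_nonneg (mul_self_nonneg _) (by positivity)
      positivity
    linarith
  -- For `k = 1` there may be a zero, but `Q = Q' = 0` would give `b = 0`.
  · have hσ : deriv (sigmaFun L.k) = Real.cos := by
      have : sigmaFun L.k = Real.sin := by ext r; simp [sigmaFun, hk]
      rw [this, Real.deriv_sin]
    have hs := sigmaFun_pos hr hx.2.2
    have hd : HasDerivAt Q (L.a (x 0) ^ 2 * (L.n * (L.n * sigmaFun L.k (x 1)))
        + L.b (x 0) ^ 2 * (- Real.sin (x 1))) (x 1) := by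
      rw [hQ, hσ]
      exact (((hasDerivAt_twist (L := L) (x 1)).const_mul _).const_mul _).add
        ((Real.hasDerivAt_cos _).const_mul _)
    have hd0 := hd.unique ((hasDerivAt_const (x 1) (0 : ℝ)).congr_of_eventuallyEq hev)
    have hsin : sigmaFun L.k (x 1) = Real.sin (x 1) := by simp [sigmaFun, hk]
    rw [hsin] at hd0 hs
    have hab : L.a (x 0) ^ 2 * (L.n * L.n) = L.b (x 0) ^ 2 := by
      have : Real.sin (x 1) * (L.a (x 0) ^ 2 * (L.n * L.n) - L.b (x 0) ^ 2) = 0 := by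
        rw [← hd0]; ring
      linarith [(mul_eq_zero.1 this).resolve_left hs.ne']
    have : Q (x 1) = L.b (x 0) ^ 2 := by
      simp only [hQ, hσ]
      simp only [fFun, hk]
      norm_num
      rw [← hab]
      ring
    rw [this] at hQ0
    exact absurd hQ0 (by positivity)

/-- The Killing fields which are tangent to the hypersurfaces `t = const` and commute with `∂_φ`
are the linear combinations of `∂_φ` and `∂_z` with constant coefficients. -/
theorem exists_eq_const {ξ : Coords 4 → Coords 4} (hξ : ξ ∈ L.isometriesOnS3)
    (hcomm : ∀ x ∈ L.domain, VectorField.lieBracket ℝ axialField ξ x = 0) :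
    ∃ P Z : ℝ, ∀ x ∈ L.domain, ξ x = ![0, 0, P, Z] := by
  have hdiff : ∀ x ∈ L.domain, DifferentiableAt ℝ ξ x := fun x hx =>
    (hξ.1.1.contDiffAt (L.isOpen_domain.mem_nhds hx)).differentiableAt (by norm_num)
  have hax : ∀ x, axialField x = Pi.single 2 1 := fun x => by
    ext i; fin_cases i <;> simp [axialField]
  have hcomm' : ∀ x ∈ L.domain, ∀ μ, pderiv 2 (fun y => ξ y μ) x = 0 := by
    intro x hx μ
    have h := hcomm x hx
    have hc : fderiv ℝ axialField x = 0 := by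
      unfold axialField; simp
    rw [VectorField.lieBracket, hc, zero_apply, sub_zero, hax] at h
    rw [pderiv, fderiv_apply (hdiff x hx)]
    exact congrFun h μ
  have hR := fun x hx => radial_component_eq_zero (x := x) hξ hcomm' hx
  have hzero : ∀ x ∈ L.domain, ∀ i μ, pderiv i (fun y => ξ y μ) x = 0 := by
    intro x hx
    have h0 : ∀ i, pderiv i (fun y => ξ y 0) x = 0 := fun i => by
      rw [pderiv_congr L.isOpen_domain (h := fun _ => 0) hξ.2 i hx, pderiv_const]
    have h1 : ∀ i, pderiv i (fun y => ξ y 1) x = 0 := fun i => by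
      rw [pderiv_congr L.isOpen_domain (h := fun _ => 0) hR i hx, pderiv_const]
    have ha := L.a_pos _ hx.1
    have hb := L.b_pos _ hx.1
    have hσ := sigmaFun_pos hx.2.1 hx.2.2
    set p := L.metric x 2 2 with hp
    set q := L.metric x 2 3 with hq
    set s := L.metric x 3 3 with hs
    have hq' : L.metric x 3 2 = q := (L.metric_isSymm x).apply _ _
    -- The block of the orbit directions `φ`, `z` is positive definite.
    have hdet : p * s - q ^ 2 ≠ 0 := by
      have : p * s - q ^ 2 = L.a (x 0) ^ 2 * L.b (x 0) ^ 2 * sigmaFun L.k (x 1) ^ 2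
          + L.b (x 0) ^ 2 * (L.ε * x 1) ^ 2 * p := by
        simp only [hp, hq, hs, metric_eq]
        simp
        ring
      have hp0 : 0 ≤ p := by
        simp only [hp, metric_eq]
        simp
        positivity
      rw [this]
      positivity
    have hsolve : ∀ u v : ℝ, p * u + q * v = 0 → q * u + s * v = 0 → u = 0 ∧ v = 0 := by
      intro u v e1 e2
      constructor
      · refine (mul_eq_zero.1 (?_ : (p * s - q ^ 2) * u = 0)).resolve_left hdet
        linear_combination s * e1 - q * e2
      · refine (mul_eq_zero.1 (?_ : (p * s - q ^ 2) * v = 0)).resolve_left hdet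
        linear_combination p * e2 - q * e1
    have h2 := hcomm' x hx
    have kil : ∀ μ ν, pderiv μ (fun y => ξ y 2) x * L.metric x 2 ν
        + pderiv μ (fun y => ξ y 3) x * L.metric x 3 ν
        + (L.metric x μ 2 * pderiv ν (fun y => ξ y 2) x
        + L.metric x μ 3 * pderiv ν (fun y => ξ y 3) x) = 0 := by
      intro μ ν
      have h := hξ.1.2 x hx μ ν
      simp only [lieMetric, Fin.sum_univ_four, hξ.2 x hx, hR x hx, pderiv_metric_two,
        pderiv_metric_three, h0, h1] at h
      linarith
    have hz : pderiv 3 (fun y => ξ y 2) x = 0 ∧ pderiv 3 (fun y => ξ y 3) x = 0 := by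
      apply hsolve
      · have := kil 3 2
        rw [h2, h2, hq', ← hp] at this
        linarith
      · have := kil 3 3
        rw [hq', ← hq, ← hs] at this
        linarith
    have hall : ∀ i, pderiv i (fun y => ξ y 2) x = 0 ∧ pderiv i (fun y => ξ y 3) x = 0 := by
      intro i
      apply hsolve
      · have := kil i 2
        rw [h2, h2, hq', ← hp] at this
        linarith
      · have := kil i 3
        rw [hz.1, hz.2, ← hq, ← hs] at this
        linarith
    intro i μ
    fin_cases μ
    · exact h0 i
    · exact h1 i
    · exact (hall i).1
    · exact (hall i).2
  have hf : Set.EqOn (fderiv ℝ ξ) 0 L.domain := by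
    intro x hx
    ext v μ
    have h : fderiv ℝ (fun y => ξ y μ) x v = 0 := by
      rw [fderiv_apply_eq_sum_pderiv]
      simp [hzero x hx]
    rw [fderiv_apply (hdiff x hx)] at h
    exact h
  obtain ⟨w, hw⟩ := L.isOpen_domain.exists_is_const_of_fderiv_eq_zero
    L.convex_domain.isPreconnected (fun x hx => (hdiff x hx).differentiableWithinAt) hf
  refine ⟨w 2, w 3, fun x hx => ?_⟩
  ext μ
  have h0 := hξ.2 x hx
  have h1 := hR x hx
  rw [hw x hx] at h0 h1 ⊢
  fin_cases μ <;> simp [h0, h1]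

end LRSSpacetime

/-! ### The evolution of the scale factors on the hypersurface -/

/-- At every point of the hypersurface there is a direction, transversal to the hypersurfaces
`t = const`, along which the products of the generators of the cylindrical symmetry do not change:
it corresponds to the timelike direction `∂_T` of the static spacetime. -/
theorem exists_stationary_direction {L : LRSSpacetime} {S : StaticCylindricalSpacetime}
    {U : Set (Coords 3)} (hU : IsOpen U) {Φp Φm : Coords 3 → Coords 4}
    (hmatch : IsMatching L.metric L.domain S.metric S.domain U Φp Φm)
    (hsymm : PreservesCylindricalSymmetry L.metric L.domain L.isometriesOnS3
      S.metric S.domain S.isometriesG3 U Φp Φm) {p : Coords 3} (hp : p ∈ U) :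
    ∃ X : Coords 4, X 0 ≠ 0 ∧
      X 0 * pderiv 0 (fun y => L.metric y 2 2) (Φp p)
        + X 1 * pderiv 1 (fun y => L.metric y 2 2) (Φp p) = 0 ∧
      X 0 * pderiv 0 (fun y => L.metric y 2 3) (Φp p)
        + X 1 * pderiv 1 (fun y => L.metric y 2 3) (Φp p) = 0 ∧
      X 0 * pderiv 0 (fun y => L.metric y 3 3) (Φp p)
        + X 1 * pderiv 1 (fun y => L.metric y 3 3) (Φp p) = 0 := by
  obtain ⟨ξ₁, ξ₂, γ, δ, hG₁, hG₂, hγ, hδ, hγ₁, hγ₂, hδ₁, hδ₂⟩ := hsymm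
  obtain ⟨P, Z, hPZ⟩ := LRSSpacetime.exists_eq_const hG₁.mem₂ hG₁.commute
  obtain ⟨c, a, b, rfl⟩ := hG₂.mem₂
  have hx := hmatch.hyp₁.mapsTo hp
  have hy := hmatch.hyp₂.mapsTo hp
  -- Otherwise `P ∂_φ - ξ₁` would be a trivial combination of the generators.
  have hZ : Z ≠ 0 := by
    rintro rfl
    have h := hG₁.spacelike p hp P (-1) (by simp)
    have h0 : P • axialField (Φp p) + (-1 : ℝ) • ξ₁ (Φp p) = 0 := by
      rw [hPZ _ hx]
      ext μ
      fin_cases μ <;> simp [axialField]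
    rw [h0] at h
    simp [gdot] at h
  obtain ⟨X, hXX, hX⟩ := hmatch.exists_vector hU
    (fun x _ => L.metric_isSymm x) (fun x _ => S.metric_isSymm x)
    (fun x hx => LRSSpacetime.isUnit_det_metric hx)
    (fun x hx => StaticCylindricalSpacetime.isUnit_det_metric hx)
    (fun x hx => LRSSpacetime.differentiableAt_metric hx)
    (fun x hx => StaticCylindricalSpacetime.differentiableAt_metric hx)
    (γ := ![γ, δ]) (u₁ := ![![0, 0, 1, 0], ![0, 0, P, Z]]) (u₂ := ![![0, 0, 1, 0], ![c, 0, a, b]])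
    (by intro i; fin_cases i <;> assumption)
    (by
      intro i q hq
      fin_cases i
      · exact hγ₁ q hq
      · exact (hδ₁ q hq).trans (hPZ _ (hmatch.hyp₁.mapsTo hq)))
    (by
      intro i q hq
      fin_cases i
      · exact hγ₂ q hq
      · exact hδ₂ q hq)
    (by
      intro i x _ α β
      fin_cases i <;> simp [Fin.sum_univ_four, LRSSpacetime.pderiv_metric_two,
        LRSSpacetime.pderiv_metric_three])
    (by
      intro i x _ α β
      have h := fun (j : Fin 4) (hj : j ≠ 1) =>
        StaticCylindricalSpacetime.pderiv_metric (S := S) hj x α β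
      fin_cases i <;> simp [Fin.sum_univ_four, h])
    hp ![1, 0, 0, 0]
  have hA := S.A_pos _ hy
  have hneg : gdot (L.metric (Φp p)) X X < 0 := by
    rw [hXX]
    have : gdot (S.metric (Φm p)) ![1, 0, 0, 0] ![1, 0, 0, 0] = - S.A (Φm p 1) ^ 2 := by
      simp [gdot_eq_sum, Fin.sum_univ_four, StaticCylindricalSpacetime.metric]
    rw [this]
    exact neg_neg_of_pos (by positivity)
  have hstat : ∀ u v : Coords 4, metricDeriv S.metric (Φm p) ![1, 0, 0, 0] u v = 0 := by
    intro u v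
    simp [metricDeriv, Fin.sum_univ_four,
      StaticCylindricalSpacetime.pderiv_metric (S := S) (show (0 : Fin 4) ≠ 1 by decide)]
  have h32 : (fun y => L.metric y 3 2) = fun y => L.metric y 2 3 := by
    ext y
    exact (L.metric_isSymm y).apply _ _
  have h00 := (hX 0 0).trans (hstat _ _)
  have h01 := (hX 0 1).trans (hstat _ _)
  have h11 := (hX 1 1).trans (hstat _ _)
  simp only [metricDeriv, Fin.sum_univ_four, LRSSpacetime.pderiv_metric_two,
    LRSSpacetime.pderiv_metric_three, h32] at h00 h01 h11
  simp at h00 h01 h11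
  have e23 : X 0 * pderiv 0 (fun y => L.metric y 2 3) (Φp p)
      + X 1 * pderiv 1 (fun y => L.metric y 2 3) (Φp p) = 0 := by
    refine (mul_eq_zero.1 (?_ : Z * _ = 0)).resolve_left hZ
    linear_combination h01 - P * h00
  refine ⟨X, LRSSpacetime.time_component_ne_zero hneg, h00, e23, ?_⟩
  refine (mul_eq_zero.1 (?_ : Z ^ 2 * _ = 0)).resolve_left (pow_ne_zero 2 hZ)
  linear_combination h11 - P ^ 2 * h00 - 2 * P * Z * e23

/-- The first-order form of the result: `a` is stationary at the times which occur on the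
hypersurface, and so is `b` if the orbits of the isometry group are twisted. -/
theorem deriv_scale_factors {L : LRSSpacetime} {S : StaticCylindricalSpacetime}
    {U : Set (Coords 3)} (hU : IsOpen U) {Φp Φm : Coords 3 → Coords 4}
    (hmatch : IsMatching L.metric L.domain S.metric S.domain U Φp Φm)
    (hsymm : PreservesCylindricalSymmetry L.metric L.domain L.isometriesOnS3
      S.metric S.domain S.isometriesG3 U Φp Φm) {t : ℝ} (ht : t ∈ L.timesOn U Φp) :
    deriv L.a t = 0 ∧ (L.n = 1 → deriv L.b t = 0) := by
  obtain ⟨p, hp, rfl⟩ := ht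
  obtain ⟨X, hX, e22, e23, e33⟩ := exists_stationary_direction hU hmatch hsymm hp
  have hx := hmatch.hyp₁.mapsTo hp
  have ha := L.a_pos _ hx.1
  have hb := L.b_pos _ hx.1
  have hσ := sigmaFun_pos hx.2.1 hx.2.2
  rw [(LRSSpacetime.pderiv_metric_two_two hx).1, (LRSSpacetime.pderiv_metric_two_two hx).2] at e22
  rw [(LRSSpacetime.pderiv_metric_two_three hx).1,
    (LRSSpacetime.pderiv_metric_two_three hx).2] at e23
  rw [(LRSSpacetime.pderiv_metric_three_three hx).1,
    (LRSSpacetime.pderiv_metric_three_three hx).2] at e33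
  have ha' : deriv L.a (Φp p 0) = 0 := by
    refine (mul_eq_zero.1 (?_ : 2 * X 0 * L.a (Φp p 0) * deriv L.a (Φp p 0) = 0)).resolve_left
      (mul_ne_zero (mul_ne_zero two_ne_zero hX) ha.ne')
    rcases L.ε_mem with hε | hε
    · rw [hε] at e33
      push_cast at e33
      linear_combination e33
    -- For `ε = 1`, the difference `g_zz - g_φφ` is `a²`.
    · have hn : L.n = 0 := by simpa [hε] using L.ε_mul_n
      have hk : L.k = 0 := by simpa [hε] using L.ε_mul_k
      have hs : sigmaFun 0 = fun r => r := by ext r; simp [sigmaFun]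
      rw [hn, hk, hs] at e22
      rw [hε] at e33
      simp at e22 e33
      linear_combination e33 - e22
  refine ⟨ha', fun hn => ?_⟩
  rw [ha', hn] at e22 e23
  simp only [Int.cast_one, mul_zero, zero_mul, zero_add, one_mul] at e22 e23
  have hX1 : X 1 = 0 := (mul_eq_zero.1 e23).resolve_right (by positivity)
  rw [hX1] at e22
  refine (mul_eq_zero.1
    (?_ : 2 * X 0 * L.b (Φp p 0) * sigmaFun L.k (Φp p 1) ^ 2 * deriv L.b (Φp p 0) = 0)).resolve_left
    (mul_ne_zero (mul_ne_zero (mul_ne_zero two_ne_zero hX) hb.ne') (by positivity))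
  linear_combination e22

theorem eq_of_deriv_eq_zero {s : Set ℝ} (hs : s.OrdConnected) {f : ℝ → ℝ}
    (hf : ∀ t ∈ s, HasDerivAt f 0 t) {t t' : ℝ} (ht : t ∈ s) (ht' : t' ∈ s) : f t = f t' := by
  have h := hs.convex.norm_image_sub_le_of_norm_hasDerivWithin_le (C := 0)
    (fun x hx => (hf x hx).hasDerivWithinAt) (by simp) ht' ht
  simpa [sub_eq_zero] using h

/-- The expansion of `∂_t` in the direction of the vector `∂_z + ε r ∂_r`, which is orthogonal to
`dr - ε r dz` and to `dφ`. -/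
theorem LRSSpacetime.expansionTensor_apply {L : LRSSpacetime} {x : Coords 4}
    (hx : x ∈ L.domain) :
    ∑ α, ∑ β, expansionTensor L.metric (fun _ => ![1, 0, 0, 0]) x α β
        * (![0, L.ε * x 1, 0, 1] : Coords 4) α * (![0, L.ε * x 1, 0, 1] : Coords 4) β
      = L.a (x 0) * deriv L.a (x 0) := by
  have hlie : ∀ α β, expansionTensor L.metric (fun _ => ![1, 0, 0, 0]) x α β
      = 1 / 2 * pderiv 0 (fun y => L.metric y α β) x := by
    intro α β
    simp [expansionTensor, lieMetric, Fin.sum_univ_four, pderiv_const]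
  have hb := (hasDerivAt_b hx.1).fun_pow 2
  have h11 := (pderiv_separated hb (hasDerivAt_const (x 0) (0 : ℝ))
    (hasDerivAt_const (x 1) (1 : ℝ)) (hasDerivAt_const (x 1) (0 : ℝ))).1
  have h13 := (pderiv_separated hb (hasDerivAt_const (x 0) (0 : ℝ))
    (((hasDerivAt_id (x 1)).const_mul (L.ε : ℝ)).fun_neg) (hasDerivAt_const (x 1) (0 : ℝ))).1
  have h33 := (pderiv_metric_three_three hx).1
  have e11 : (fun y => L.metric y 1 1)
      = fun y : Coords 4 => L.b (y 0) ^ 2 * 1 + 0 * 0 := by ext y; simp [metric_eq]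
  have e13 : (fun y => L.metric y 1 3)
      = fun y : Coords 4 => L.b (y 0) ^ 2 * -(L.ε * id (y 1)) + 0 * 0 := by
    ext y; simp [metric_eq]
  have e31 : (fun y => L.metric y 3 1)
      = fun y : Coords 4 => L.b (y 0) ^ 2 * -(L.ε * id (y 1)) + 0 * 0 := by
    ext y; simp [metric_eq]
  simp only [hlie]
  simp only [Fin.sum_univ_four]
  rw [e11, e13, e31, h11, h13, h33]
  simp
  ring

end CylMatching

theorem mainTheorem1 (L : CylMatching.LRSSpacetime) (S : CylMatching.StaticCylindricalSpacetime)
    (U : Set (CylMatching.Coords 3)) (hUo : IsOpen U) (hUc : IsConnected U)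
    (Φp Φm : CylMatching.Coords 3 → CylMatching.Coords 4)
    (hmatch : CylMatching.IsMatching L.metric L.domain S.metric S.domain U Φp Φm)
    (hsymm : CylMatching.PreservesCylindricalSymmetry L.metric L.domain L.isometriesOnS3
      S.metric S.domain S.isometriesG3 U Φp Φm)
    (hnonspacelike : CylMatching.IsNonSpacelike L.metric U Φp)
    (hnonstatic : ¬ L.IsStaticOn (L.timesOn U Φp)) :
    L.n = 0 ∧ (L.ε = 0 ∨ L.ε = 1) ∧ L.ε * L.k = 0 ∧
    (∃ β : ℝ, 0 < β ∧ (∀ t ∈ L.timesOn U Φp, L.a t = β) ∧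
      ∀ x ∈ L.domain, x 0 ∈ L.timesOn U Φp →
        L.metric x = CylMatching.nonExpandingMetric β L.b L.ε L.k x) ∧
    (∀ x ∈ L.domain, x 0 ∈ L.timesOn U Φp →
      ∑ α, ∑ β, CylMatching.expansionTensor L.metric (fun _ => ![1, 0, 0, 0]) x α β
        * (![0, L.ε * x 1, 0, 1] : CylMatching.Coords 4) α
        * (![0, L.ε * x 1, 0, 1] : CylMatching.Coords 4) β = 0) := by
  have hsub : ∀ t ∈ L.timesOn U Φp, t ∈ L.times := by
    rintro _ ⟨p, hp, rfl⟩
    exact (hmatch.hyp₁.mapsTo hp).1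
  have hconn : (L.timesOn U Φp).OrdConnected :=
    (hUc.isPreconnected.image _
      ((continuous_apply 0).comp_continuousOn hmatch.hyp₁.contDiffOn.continuousOn)).ordConnected
  have hd := fun t ht => CylMatching.deriv_scale_factors (t := t) hUo hmatch hsymm ht
  obtain ⟨p₀, hp₀⟩ := hUc.nonempty
  have ht₀ : Φp p₀ 0 ∈ L.timesOn U Φp := ⟨p₀, hp₀, rfl⟩
  have haconst : ∀ t ∈ L.timesOn U Φp, L.a t = L.a (Φp p₀ 0) := fun t ht =>
    CylMatching.eq_of_deriv_eq_zero hconn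
      (fun s hs => (hd s hs).1 ▸ CylMatching.LRSSpacetime.hasDerivAt_a (hsub s hs)) ht ht₀
  have hn : L.n = 0 := by
    refine L.n_mem.resolve_right fun hn => hnonstatic ⟨_, L.b (Φp p₀ 0), fun t ht =>
      ⟨haconst t ht, ?_⟩⟩
    exact CylMatching.eq_of_deriv_eq_zero hconn
      (fun s hs => (hd s hs).2 hn ▸ CylMatching.LRSSpacetime.hasDerivAt_b (hsub s hs)) ht ht₀
  refine ⟨hn, L.ε_mem, L.ε_mul_k, ⟨L.a (Φp p₀ 0), L.a_pos _ (hsub _ ht₀), haconst, ?_⟩, ?_⟩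
  · intro x _ ht
    simp only [CylMatching.LRSSpacetime.metric, CylMatching.nonExpandingMetric, haconst _ ht, hn]
    simp
  · intro x hx ht
    rw [CylMatching.LRSSpacetime.expansionTensor_apply hx, (hd _ ht).1, mul_zero]
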